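/- For integers $n,k\ge 1$ let $H_{n,k}$ be the real vector space of homogeneous polynomials (forms) of degree $k$ in $n$ variables with real coefficients (including $0$). For $f=\sum_\alpha f_\alpha x^\alpha\in H_{n,2d}$ let $\operatorname{supp}(f)=\{\alpha\in\mathbb N_0^n: f_\alpha\neq 0\}$, let $\operatorname{New}(f)\subset\mathbb R^n$ be the convex hull of $\operatorname{supp}(f)$, let $V(f)$ be the set of vertices of $\operatorname{New}(f)$, let $S(f)=\{\alpha\in\operatorname{supp}(f):\alpha\in(2\mathbb N_0)^n,\ f_\alpha>0\}$, and let $I(f)=\operatorname{supp}(f)\setminus S(f)$. The form $f\in H_{n,2d}$ is called a circuit form if $S(f)=V(f)$, the set $V(f)$ is affinely independent, and either $I(f)=\emptyset$ or $I(f)=\{\beta\}$ with $\beta$ in the relative interior of $\operatorname{New}(f)$. Define - $P_{n,2d}$ as the set of all $f\in H_{n,2d}$ with $f(x)\ge 0$ for all $x\in\mathbb R^n$ (the PSD cone); - $\Sigma_{n,2d}$ as the set of all finite sums $\sum_{i=1}^s f_i^2$ with $f_i\in H_{n,d}$ (the SOS cone); - $C_{n,2d}$ as the set of all finite sums $\sum_{i=1}^s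 f_i$ of circuit forms $f_i\in H_{n,2d}$ that are nonnegative on $\mathbb R^n$ (the SONC cone); - $(\Sigma+C)_{n,2d}=\{g+h: g\in\Sigma_{n,2d},\ h\in C_{n,2d}\}$ (the SOS+SONC cone). Theorem. Let $n\ge 2$ and $d\ge 1$ be integers such that $(n,2d)$ is not a Hilbert case, that is, $n\neq 2$, $2d\neq 2$ and $(n,2d)\neq(3,4)$. Then $$\Sigma_{n,2d}\cup C_{n,2d}\ \subsetneq\ (\Sigma+C)_{n,2d}\ \subsetneq\ P_{n,2d}.$$ -/

import Mathlib

namespace SosSonc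

/-- The space `H_{n,k}` of real forms of degree `k` in `n` variables. -/
abbrev Forms (n k : ℕ) : Submodule ℝ (MvPolynomial (Fin n) ℝ) :=
  MvPolynomial.homogeneousSubmodule (Fin n) ℝ k

/-- An exponent `α ∈ ℕ₀ⁿ`, viewed as a point of `ℝⁿ`. -/
def toPoint {n : ℕ} (α : Fin n →₀ ℕ) : Fin n → ℝ := fun i => (α i : ℝ)

/-- The Newton polytope `New(f) = conv (supp f)`. -/
def newton {n : ℕ} (f : MvPolynomial (Fin n) ℝ) : Set (Fin n → ℝ) :=
  convexHull ℝ (toPoint '' (f.support : Set (Fin n →₀ ℕ)))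

/-- The set `V(f)` of vertices of the Newton polytope of `f`. -/
def vertices {n : ℕ} (f : MvPolynomial (Fin n) ℝ) : Set (Fin n → ℝ) :=
  (newton f).extremePoints ℝ

/-- The set `S(f)` of the exponents of the monomial squares of `f`:
all entries are even and the coefficient is positive. -/
def squareExponents {n : ℕ} (f : MvPolynomial (Fin n) ℝ) : Set (Fin n →₀ ℕ) :=
  {α | α ∈ f.support ∧ (∀ i, Even (α i)) ∧ 0 < f.coeff α}

/-- The set `I(f) = supp f \ S(f)` of the remaining exponents. -/
def innerExponents {n : ℕ} (f : MvPolynomial (Fin n) ℝ) : Set (Fin n →₀ ℕ) :=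
  (f.support : Set (Fin n →₀ ℕ)) \ squareExponents f

/-- The cone `P_{n,2d}` of positive semidefinite forms. -/
def PSD (n d : ℕ) : Set (MvPolynomial (Fin n) ℝ) :=
  {f | f ∈ Forms n (2 * d) ∧ ∀ x : Fin n → ℝ, 0 ≤ MvPolynomial.eval x f}

/-- The cone `Σ_{n,2d}` of sums of squares of forms of degree `d`. -/
def SOS (n d : ℕ) : Set (MvPolynomial (Fin n) ℝ) :=
  {f | f ∈ Forms n (2 * d) ∧ ∃ s : ℕ, 0 < s ∧ ∃ g : Fin s → MvPolynomial (Fin n) ℝ,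
    (∀ i, g i ∈ Forms n d) ∧ f = ∑ i, g i ^ 2}

/-- The circuit forms of degree `2d` in `n` variables. -/
structure IsCircuit (n d : ℕ) (f : MvPolynomial (Fin n) ℝ) : Prop where
  mem_forms : f ∈ Forms n (2 * d)
  squareExponents_eq : toPoint '' squareExponents f = vertices f
  affineIndependent : AffineIndependent ℝ (fun v : vertices f => (v : Fin n → ℝ))
  inner : (∃ β : Fin n →₀ ℕ, innerExponents f = {β} ∧
      toPoint β ∈ intrinsicInterior ℝ (newton f)) ∨ innerExponents f = ∅

/-- The cone `C_{n,2d}` of sums of nonnegative circuit forms. -/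
def SONC (n d : ℕ) : Set (MvPolynomial (Fin n) ℝ) :=
  {f | f ∈ Forms n (2 * d) ∧ ∃ s : ℕ, 0 < s ∧ ∃ g : Fin s → MvPolynomial (Fin n) ℝ,
    (∀ i, IsCircuit n d (g i) ∧ g i ∈ PSD n d) ∧ f = ∑ i, g i}

/-- The cone `(Σ+C)_{n,2d}`, the Minkowski sum of `Σ_{n,2d}` and `C_{n,2d}`. -/
def SOSplusSONC (n d : ℕ) : Set (MvPolynomial (Fin n) ℝ) :=
  {f | ∃ g ∈ SOS n d, ∃ h ∈ SONC n d, f = g + h}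

/-- The Hilbert cases: `n = 2`, or `2d = 2`, or `(n, 2d) = (3, 4)`. -/
def IsHilbertCase (n d : ℕ) : Prop :=
  n = 2 ∨ 2 * d = 2 ∨ (n = 3 ∧ 2 * d = 4)

end SosSonc

/-! Everything rests on one circuit form F = ∑ x^(2 a i) - k x^β, with β the barycenter of the k
vertices 2 a i. It is nonnegative by AM-GM. If β is not a sum of two different exponents from the
convex hull of the a i (`IsRigidSimplex`), then in any sum of squares with F's Newton polytope the
coefficient at β is itself a sum of squares, so F is not SOS. The Motzkin form times z^(2l) serves n
≥ 3, d ≥ 3, and the Choi-Lam form serves n ≥ 4, d = 2; these are all the non-Hilbert cases.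

For the first strict inclusion, add q² with q = x^(a i₀) + x^(a i₁) - x^(a i₂). The coefficient at β
stays negative, so the sum is not SOS. It is not SONC either: flipping one sign shows that SONC
forms satisfy f(1) ≥ 2 f_γ whenever γ has an odd entry, while here f(1) = 1 and f_γ = 2 at γ = a i₀
+ a i₁.

For the second, a nonnegative circuit form vanishing at 1 and at the coordinatewise square r² of a
generic r is zero (`eq_zero_of_two_zeros`). Hence an SOS+SONC form with these zeros is SOS. Since F
vanishes at 1 and at a nonconstant sign vector, an invertible linear substitution moves its zeros to
1 and r²; the result is PSD and not SOS, hence not SOS+SONC. -/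

namespace SosSonc
open MvPolynomial

/-! ### Evaluation of monomials -/

/-- The value of the monomial `x ^ γ` at a point `x`. -/
def mono {n : ℕ} (x : Fin n → ℝ) (γ : Fin n →₀ ℕ) : ℝ := ∏ i, x i ^ γ i

lemma mono_add {n : ℕ} (x : Fin n → ℝ) (γ δ : Fin n →₀ ℕ) :
    mono x (γ + δ) = mono x γ * mono x δ := by
  simp [mono, pow_add, Finset.prod_mul_distrib]

lemma mono_nsmul {n : ℕ} (x : Fin n → ℝ) (m : ℕ) (γ : Fin n →₀ ℕ) :
    mono x (m • γ) = mono x γ ^ m := by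
  simp [mono, pow_mul', Finset.prod_pow]

lemma mono_sum {n : ℕ} {ι : Type*} (x : Fin n → ℝ) (s : Finset ι) (γ : ι → Fin n →₀ ℕ) :
    mono x (∑ i ∈ s, γ i) = ∏ i ∈ s, mono x (γ i) := by
  classical
  induction s using Finset.induction_on with
  | empty => simp [mono]
  | insert i s hi ih => rw [Finset.sum_insert hi, Finset.prod_insert hi, mono_add, ih]

lemma mono_one {n : ℕ} (γ : Fin n →₀ ℕ) : mono (1 : Fin n → ℝ) γ = 1 := by simp [mono]

lemma mono_sq {n : ℕ} (x : Fin n → ℝ) (γ : Fin n →₀ ℕ) :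
    mono (fun i => x i ^ 2) γ = mono x γ ^ 2 := by
  simp only [mono, ← Finset.prod_pow, ← pow_mul, mul_comm]

lemma eval_monomial_eq_mono {n : ℕ} (x : Fin n → ℝ) (γ : Fin n →₀ ℕ) (c : ℝ) :
    eval x (monomial γ c) = c * mono x γ := by
  rw [eval_monomial, Finsupp.prod_fintype _ _ (by simp), mono]

lemma eval_eq_sum_mono {n : ℕ} (x : Fin n → ℝ) (f : MvPolynomial (Fin n) ℝ) :
    eval x f = ∑ γ ∈ f.support, f.coeff γ * mono x γ := eval_eq' x f

/-! ### Weights and Newton polytopes of sums of squares -/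

/-- The substitution `X i ↦ x i * T ^ w i`. -/
noncomputable def weightSubst {n : ℕ} (w : Fin n → ℕ) (x : Fin n → ℝ) :
    MvPolynomial (Fin n) ℝ →ₐ[ℝ] Polynomial ℝ :=
  aeval fun i => Polynomial.C (x i) * Polynomial.X ^ w i

lemma weightSubst_monomial {n : ℕ} (w : Fin n → ℕ) (x : Fin n → ℝ) (γ : Fin n →₀ ℕ) (c : ℝ) :
    weightSubst w x (monomial γ c) =
      Polynomial.monomial (Finsupp.weight w γ) (c * mono x γ) := by
  rw [weightSubst, aeval_monomial, Finsupp.prod_fintype _ _ (by simp), mono,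
    ← Polynomial.C_mul_X_pow_eq_monomial, Finsupp.weight_apply, Finsupp.sum_fintype _ _ (by simp),
    Polynomial.algebraMap_eq]
  simp only [mul_pow, Finset.prod_mul_distrib, map_mul, map_prod, map_pow, smul_eq_mul, ← pow_mul,
    Finset.prod_pow_eq_pow_sum, mul_comm (w _), mul_assoc]

lemma coeff_weightSubst {n : ℕ} (w : Fin n → ℕ) (x : Fin n → ℝ) (f : MvPolynomial (Fin n) ℝ)
    (m : ℕ) : (weightSubst w x f).coeff m = eval x (weightedHomogeneousComponent w m f) := by
  induction f using MvPolynomial.induction_on' with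
  | monomial γ c =>
    rw [weightSubst_monomial, Polynomial.coeff_monomial]
    split_ifs with h
    · rw [(isWeightedHomogeneous_monomial w γ c h).weightedHomogeneousComponent_same,
        eval_monomial_eq_mono]
    · rw [(isWeightedHomogeneous_monomial w γ c rfl).weightedHomogeneousComponent_ne _
        (Ne.symm h), map_zero]
  | add p q hp hq => simp [hp, hq]

lemma natDegree_weightSubst_le {n : ℕ} (w : Fin n → ℕ) (x : Fin n → ℝ)
    (f : MvPolynomial (Fin n) ℝ) (m : ℕ) (hf : ∀ γ ∈ f.support, Finsupp.weight w γ ≤ m) :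
    (weightSubst w x f).natDegree ≤ m := by
  rw [Polynomial.natDegree_le_iff_coeff_eq_zero]
  intro N hN
  rw [coeff_weightSubst, weightedHomogeneousComponent_eq_zero', map_zero]
  intro γ hγ h
  have := hf γ hγ
  omega

/-- If all monomials of a sum of squares have weight at most `2 * c`, then all monomials of the
summands have weight at most `c`. -/
theorem weight_le_of_sum_sq {n s : ℕ} (w : Fin n → ℕ) (c : ℕ)
    (g : Fin s → MvPolynomial (Fin n) ℝ)
    (hF : ∀ γ ∈ (∑ i, g i ^ 2).support, Finsupp.weight w γ ≤ 2 * c) (i : Fin s) :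
    ∀ γ ∈ (g i).support, Finsupp.weight w γ ≤ c := by
  let W : ℕ := Finset.univ.sup fun j => (g j).support.sup fun γ => Finsupp.weight w γ
  have hW : ∀ j, ∀ γ ∈ (g j).support, Finsupp.weight w γ ≤ W := fun j γ hγ =>
    (Finset.le_sup (f := fun γ => Finsupp.weight w γ) hγ).trans
      (Finset.le_sup (f := fun j => (g j).support.sup fun γ => Finsupp.weight w γ)
        (Finset.mem_univ j))
  suffices hc : W ≤ c from fun γ hγ => (hW i γ hγ).trans hc
  by_contra! hc
  -- The coefficient of T^(2W) is a sum of real squares, and it vanishes because 2W > 2c.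
  have hzero : ∀ j, weightedHomogeneousComponent w W (g j) = 0 := by
    intro j
    refine MvPolynomial.funext fun x => ?_
    have h1 : (weightSubst w x (∑ i, g i ^ 2)).coeff (W * 2) = 0 :=
      Polynomial.coeff_eq_zero_of_natDegree_lt
        ((natDegree_weightSubst_le w x _ _ hF).trans_lt (by omega))
    rw [map_sum, Polynomial.finsetSum_coeff] at h1
    have h2 : ∀ j, (weightSubst w x (g j ^ 2)).coeff (W * 2)
        = eval x (weightedHomogeneousComponent w W (g j)) ^ 2 := by
      intro j
      rw [map_pow, mul_comm, Polynomial.coeff_pow_of_natDegree_le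
        (natDegree_weightSubst_le w x _ _ (hW j)), coeff_weightSubst]
    simp only [h2] at h1
    rw [Finset.sum_eq_zero_iff_of_nonneg fun _ _ => sq_nonneg _] at h1
    simpa using h1 j (Finset.mem_univ j)
  -- Absurd, as c < W makes W positive and the subtraction genuine.
  have hlt : W ≤ W - 1 := by
    refine Finset.sup_le fun j _ => Finset.sup_le fun γ hγ => ?_
    have h1 := hW j γ hγ
    have h2 : Finsupp.weight w γ ≠ W := by
      classical
      intro h
      have h3 := congrArg (coeff γ) (hzero j)
      rw [coeff_weightedHomogeneousComponent, if_pos h, coeff_zero] at h3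
      exact mem_support_iff.mp hγ h3
    omega
  omega

/-! ### Circuit forms: zeros and odd exponents -/

lemma IsCircuit.exists_forall_coeff_nonneg {n d : ℕ} {h : MvPolynomial (Fin n) ℝ}
    (hh : IsCircuit n d h) : ∃ β, ∀ α, α ≠ β → 0 ≤ h.coeff α := by
  have key : ∀ α, α ∉ innerExponents h → 0 ≤ h.coeff α := by
    intro α hα
    by_cases hs : α ∈ h.support
    · by_contra hneg
      exact hα ⟨hs, fun hS => hneg hS.2.2.le⟩
    · rw [notMem_support_iff.mp hs]
  rcases hh.inner with ⟨β, hβ, -⟩ | hI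
  · exact ⟨β, fun α hα => key α (by simpa [hβ] using hα)⟩
  · exact ⟨0, fun α _ => key α (by simp [hI])⟩

/-- A nonnegative polynomial with at most one negative coefficient that vanishes at two generic
points of the positive orthant is zero. -/
theorem eq_zero_of_two_zeros {n : ℕ} {h : MvPolynomial (Fin n) ℝ} {β : Fin n →₀ ℕ}
    (hβ : ∀ α, α ≠ β → 0 ≤ h.coeff α) (hpos : ∀ x : Fin n → ℝ, 0 ≤ eval x h)
    {r : Fin n → ℝ} (hr0 : ∀ i, 0 ≤ r i) (hr : Function.Injective (mono r))
    (h1 : eval 1 h = 0) (h2 : eval (fun i => r i ^ 2) h = 0) : h = 0 := by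
  -- Expanding the square gives R² h(1) - 2R h(r) + h(r²) with R = r^β. This is at most 0 when h(1)
  -- = h(r²) = 0, yet every term is nonnegative: the only possibly negative coefficient is
  -- multiplied by 0.
  have key : ∑ α ∈ h.support, h.coeff α * (mono r β - mono r α) ^ 2
      = eval 1 h * mono r β ^ 2 + eval (fun i => r i ^ 2) h - 2 * mono r β * eval r h := by
    simp only [eval_eq_sum_mono, mono_one, mono_sq, Finset.mul_sum, Finset.sum_mul]
    rw [← Finset.sum_add_distrib, ← Finset.sum_sub_distrib]
    exact Finset.sum_congr rfl fun _ _ => by ring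
  have hR : 0 ≤ mono r β := Finset.prod_nonneg fun i _ => pow_nonneg (hr0 i) _
  have hterm : ∀ α ∈ h.support, 0 ≤ h.coeff α * (mono r β - mono r α) ^ 2 := by
    intro α _
    by_cases hα : α = β
    · simp [hα]
    · exact mul_nonneg (hβ α hα) (sq_nonneg _)
  have hsum : ∑ α ∈ h.support, h.coeff α * (mono r β - mono r α) ^ 2 = 0 := by
    refine le_antisymm ?_ (Finset.sum_nonneg hterm)
    rw [key, h1, h2]
    nlinarith [mul_nonneg hR (hpos r)]
  rw [Finset.sum_eq_zero_iff_of_nonneg hterm] at hsum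
  have hmon : h = monomial β (h.coeff β) := by
    classical
    ext α
    rw [coeff_monomial]
    split_ifs with hα
    · rw [hα]
    · by_contra hne
      have h3 := hsum α (mem_support_iff.mpr hne)
      rw [mul_eq_zero, or_iff_right hne, sq_eq_zero_iff, sub_eq_zero] at h3
      exact hα (hr h3)
  rw [hmon, eval_monomial_eq_mono, mono_one, mul_one] at h1
  rw [hmon, h1, monomial_zero]

/-- Negating a coordinate in which γ is odd changes only the γ-term, since all other exponents of a
circuit form containing γ are even. The left side is then the value at that sign vector. -/
lemma IsCircuit.eval_one_sub_two_mul_coeff_nonneg {n d : ℕ} {h : MvPolynomial (Fin n) ℝ}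
    (hh : IsCircuit n d h) (hpos : h ∈ PSD n d) {γ : Fin n →₀ ℕ} (hγ : ¬ ∀ i, Even (γ i)) :
    0 ≤ eval 1 h - 2 * h.coeff γ := by
  by_cases hs : γ ∈ h.support
  · have hI : γ ∈ innerExponents h := ⟨hs, fun hS => hγ hS.2.1⟩
    obtain ⟨i, hi⟩ := not_forall.mp hγ
    have heven : ∀ α ∈ h.support, α ≠ γ → ∀ i, Even (α i) := by
      intro α hα hne
      by_contra hodd
      have hI' : α ∈ innerExponents h := ⟨hα, fun hS => hodd hS.2.1⟩
      rcases hh.inner with ⟨β, hβ, -⟩ | h0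
      · rw [hβ] at hI hI'
        exact hne (hI'.trans hI.symm)
      · simp [h0] at hI
    let σ : Fin n → ℝ := Function.update 1 i (-1)
    have hσ : ∀ α : Fin n →₀ ℕ, mono σ α = (-1) ^ α i := by
      intro α
      rw [mono, Finset.prod_eq_single i]
      · simp [σ]
      · intro j _ hj
        simp [σ, hj]
      · simp
    have hval : eval σ h = eval 1 h - 2 * h.coeff γ := by
      rw [eval_eq_sum_mono, eval_eq_sum_mono, ← Finset.add_sum_erase _ _ hs,
        ← Finset.add_sum_erase _ _ hs, Finset.sum_congr rfl (g := fun α => h.coeff α * mono 1 α)]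
      · rw [hσ, (Nat.not_even_iff_odd.mp hi).neg_one_pow, mono_one]
        ring
      · intro α hα
        rw [hσ, (heven α (Finset.mem_of_mem_erase hα) (Finset.ne_of_mem_erase hα) i).neg_one_pow,
          mono_one]
    rw [← hval]
    exact hpos.2 σ
  · rw [notMem_support_iff.mp hs]
    simpa using hpos.2 1

theorem SONC.eval_one_sub_two_mul_coeff_nonneg {n d : ℕ} {f : MvPolynomial (Fin n) ℝ}
    (hf : f ∈ SONC n d) {γ : Fin n →₀ ℕ} (hγ : ¬ ∀ i, Even (γ i)) :
    0 ≤ eval 1 f - 2 * f.coeff γ := by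
  obtain ⟨-, s, -, g, hg, rfl⟩ := hf
  rw [map_sum, coeff_sum, Finset.mul_sum, ← Finset.sum_sub_distrib]
  exact Finset.sum_nonneg fun i _ => (hg i).1.eval_one_sub_two_mul_coeff_nonneg (hg i).2 hγ

/-! ### Inclusions of the cones, and forms with two prescribed zeros -/

lemma zero_mem_SOS (n d : ℕ) : (0 : MvPolynomial (Fin n) ℝ) ∈ SOS n d :=
  ⟨Submodule.zero_mem _, 1, one_pos, fun _ => 0, fun _ => Submodule.zero_mem _, by simp⟩

lemma zero_mem_PSD (n d : ℕ) : (0 : MvPolynomial (Fin n) ℝ) ∈ PSD n d :=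
  ⟨Submodule.zero_mem _, by simp⟩

lemma isCircuit_zero (n d : ℕ) : IsCircuit n d 0 where
  mem_forms := Submodule.zero_mem _
  squareExponents_eq := by simp [squareExponents, vertices, newton]
  affineIndependent := by
    have : IsEmpty (vertices (0 : MvPolynomial (Fin n) ℝ)) := by simp [vertices, newton]
    exact affineIndependent_of_subsingleton _ _
  inner := Or.inr (by simp [innerExponents])

lemma mem_SONC_of_isCircuit {n d : ℕ} {f : MvPolynomial (Fin n) ℝ} (hf : IsCircuit n d f)
    (hpos : f ∈ PSD n d) : f ∈ SONC n d :=
  ⟨hf.mem_forms, 1, one_pos, fun _ => f, fun _ => ⟨hf, hpos⟩, by simp⟩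

lemma zero_mem_SONC (n d : ℕ) : (0 : MvPolynomial (Fin n) ℝ) ∈ SONC n d :=
  mem_SONC_of_isCircuit (isCircuit_zero n d) (zero_mem_PSD n d)

lemma SOS_subset_PSD (n d : ℕ) : SOS n d ⊆ PSD n d := by
  rintro f ⟨hf, s, -, g, -, rfl⟩
  refine ⟨hf, fun x => ?_⟩
  rw [map_sum]
  exact Finset.sum_nonneg fun i _ => by rw [map_pow]; positivity

lemma SONC_subset_PSD (n d : ℕ) : SONC n d ⊆ PSD n d := by
  rintro f ⟨hf, s, -, g, hg, rfl⟩
  refine ⟨hf, fun x => ?_⟩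
  rw [map_sum]
  exact Finset.sum_nonneg fun i _ => (hg i).2.2 x

lemma SOS_union_SONC_subset (n d : ℕ) : SOS n d ∪ SONC n d ⊆ SOSplusSONC n d := by
  rintro f (hf | hf)
  · exact ⟨f, hf, 0, zero_mem_SONC n d, (add_zero f).symm⟩
  · exact ⟨0, zero_mem_SOS n d, f, hf, (zero_add f).symm⟩

lemma SOSplusSONC_subset_PSD (n d : ℕ) : SOSplusSONC n d ⊆ PSD n d := by
  rintro f ⟨g, hg, h, hh, rfl⟩
  refine ⟨Submodule.add_mem _ hg.1 hh.1, fun x => ?_⟩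
  rw [map_add]
  exact add_nonneg ((SOS_subset_PSD n d hg).2 x) ((SONC_subset_PSD n d hh).2 x)

/-- An SOS+SONC form vanishing at two generic points of the positive orthant is SOS. -/
theorem mem_SOS_of_two_zeros {n d : ℕ} {f : MvPolynomial (Fin n) ℝ} (hf : f ∈ SOSplusSONC n d)
    {r : Fin n → ℝ} (hr0 : ∀ i, 0 ≤ r i) (hr : Function.Injective (mono r))
    (h1 : eval 1 f = 0) (h2 : eval (fun i => r i ^ 2) f = 0) : f ∈ SOS n d := by
  obtain ⟨g, hg, h, hh, rfl⟩ := hf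
  have hgpos := (SOS_subset_PSD n d hg).2
  have hhpos := (SONC_subset_PSD n d hh).2
  have hzero : ∀ x, eval x (g + h) = 0 → eval x h = 0 := by
    intro x hx
    rw [map_add] at hx
    linarith [hgpos x, hhpos x]
  obtain ⟨-, s, -, c, hc, rfl⟩ := hh
  have hczero : ∀ i x, eval x (∑ i, c i) = 0 → eval x (c i) = 0 := by
    intro i x hx
    rw [map_sum, Finset.sum_eq_zero_iff_of_nonneg fun i _ => (hc i).2.2 x] at hx
    exact hx i (Finset.mem_univ i)
  have hc0 : ∀ i, c i = 0 := by
    intro i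
    obtain ⟨β, hβ⟩ := (hc i).1.exists_forall_coeff_nonneg
    exact eq_zero_of_two_zeros hβ (hc i).2.2 hr0 hr (hczero i _ (hzero _ h1))
      (hczero i _ (hzero _ h2))
  simpa [hc0] using hg

/-- Monomials separate exponents at a point with distinct prime coordinates. -/
lemma exists_injective_mono (n : ℕ) : ∃ r : Fin n → ℝ,
    (∀ i, 0 ≤ r i) ∧ Function.Injective (mono r) ∧ Function.Injective (fun i => r i ^ 2) := by
  have hp : ∀ i, (Nat.nth Nat.Prime i).Prime := Nat.prime_nth_prime
  have hinj : Function.Injective (Nat.nth Nat.Prime) :=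
    Nat.nth_injective Nat.infinite_setOfPred_prime
  refine ⟨fun i => (Nat.nth Nat.Prime i : ℝ), fun i => Nat.cast_nonneg _, ?_, ?_⟩
  · intro α β h
    have h' : ∏ i : Fin n, Nat.nth Nat.Prime i ^ α i = ∏ i : Fin n, Nat.nth Nat.Prime i ^ β i := by
      simp only [mono] at h
      exact_mod_cast h
    have hfac : ∀ (γ : Fin n →₀ ℕ) (j : Fin n),
        (∏ i : Fin n, Nat.nth Nat.Prime i ^ γ i).factorization (Nat.nth Nat.Prime j) = γ j := by
      intro γ j
      rw [Nat.factorization_prod (S := Finset.univ) (g := fun i : Fin n => Nat.nth Nat.Prime i ^ γ i)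
        fun i _ => pow_ne_zero _ (hp i).ne_zero, Finsupp.finsetSum_apply,
        Finset.sum_eq_single j]
      · simp [(hp j).factorization_pow]
      · intro i _ hij
        rw [(hp i).factorization_pow, Finsupp.single_eq_of_ne]
        exact fun h => hij (Fin.ext (hinj h)).symm
      · simp
    ext j
    rw [← hfac α j, h', hfac β j]
  · intro i j hij
    have := (pow_left_inj₀ (Nat.cast_nonneg (α := ℝ) _) (Nat.cast_nonneg _) two_ne_zero).mp hij
    exact Fin.ext (hinj (by exact_mod_cast this))

/-! ### Simplices with a dual system -/

/-- The map π reads off barycentric coordinates, turning questions about the simplex into coordinate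
inequalities. -/
lemma mem_convexHull_range_iff_of_dual {n k : ℕ} {p : Fin k → Fin n → ℝ}
    {π : (Fin n → ℝ) →ₗ[ℝ] (Fin k → ℝ)} (hπ : ∀ i, π (p i) = Pi.single i 1) (x : Fin n → ℝ) :
    x ∈ convexHull ℝ (Set.range p) ↔
      (∀ i, 0 ≤ π x i) ∧ ∑ i, π x i = 1 ∧ ∑ i, π x i • p i = x := by
  classical
  constructor
  · intro hx
    let K : Set (Fin n → ℝ) := {x | (∀ i, 0 ≤ π x i) ∧ ∑ i, π x i = 1 ∧ ∑ i, π x i • p i = x}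
    have hK : Convex ℝ K := by
      rintro y ⟨hy1, hy2, hy3⟩ z ⟨hz1, hz2, hz3⟩ s t hs ht hst
      refine ⟨fun i => ?_, ?_, ?_⟩
      · have := mul_nonneg hs (hy1 i)
        have := mul_nonneg ht (hz1 i)
        simp only [map_add, map_smul, Pi.add_apply, Pi.smul_apply, smul_eq_mul]
        positivity
      · simp [Finset.sum_add_distrib, ← Finset.mul_sum, hy2, hz2, hst]
      · simp only [map_add, map_smul, Pi.add_apply, Pi.smul_apply, smul_eq_mul, add_smul, mul_smul,
          Finset.sum_add_distrib, ← Finset.smul_sum, hy3, hz3]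
    refine convexHull_min ?_ hK hx
    rintro _ ⟨i, rfl⟩
    refine ⟨fun j => ?_, ?_, ?_⟩
    · rw [hπ, Pi.single_apply]
      split_ifs <;> simp
    · simp [hπ]
    · simp [hπ, Pi.single_apply]
  · rintro ⟨h1, h2, h3⟩
    rw [← h3]
    exact (convex_convexHull ℝ _).sum_mem (fun i _ => h1 i) h2
      fun i _ => subset_convexHull ℝ _ ⟨i, rfl⟩

lemma extremePoints_convexHull_range_of_dual {n k : ℕ} {p : Fin k → Fin n → ℝ}
    {π : (Fin n → ℝ) →ₗ[ℝ] (Fin k → ℝ)} (hπ : ∀ i, π (p i) = Pi.single i 1) :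
    (convexHull ℝ (Set.range p)).extremePoints ℝ = Set.range p := by
  refine Set.Subset.antisymm extremePoints_convexHull_subset ?_
  rintro _ ⟨i, rfl⟩
  refine ⟨subset_convexHull ℝ _ ⟨i, rfl⟩, ?_⟩
  rintro y hy z hz ⟨s, t, hs, ht, -, hst⟩
  obtain ⟨hy1, hy2, hy3⟩ := (mem_convexHull_range_iff_of_dual hπ y).mp hy
  obtain ⟨hz1, -, -⟩ := (mem_convexHull_range_iff_of_dual hπ z).mp hz
  have h0 : ∀ j, j ≠ i → π y j = 0 := by
    intro j hj
    have h := congrFun (congrArg π hst) j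
    simp only [map_add, map_smul, hπ, Pi.add_apply, Pi.smul_apply, smul_eq_mul,
      Pi.single_eq_of_ne hj] at h
    have h4 := mul_nonneg hs.le (hy1 j)
    have h5 := mul_nonneg ht.le (hz1 j)
    have h6 : s * π y j = 0 := by linarith
    exact (mul_eq_zero.mp h6).resolve_left hs.ne'
  rw [Finset.sum_eq_single i (fun j _ hj => h0 j hj) (by simp)] at hy2
  rw [Finset.sum_eq_single i (fun j _ hj => by rw [h0 j hj, zero_smul]) (by simp), hy2,
    one_smul] at hy3
  exact hy3.symm

lemma mem_intrinsicInterior_convexHull_range_of_dual {n k : ℕ} {p : Fin k → Fin n → ℝ}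
    {π : (Fin n → ℝ) →ₗ[ℝ] (Fin k → ℝ)} (hπ : ∀ i, π (p i) = Pi.single i 1) {x : Fin n → ℝ}
    (hx : x ∈ convexHull ℝ (Set.range p)) (hpos : ∀ i, 0 < π x i) :
    x ∈ intrinsicInterior ℝ (convexHull ℝ (Set.range p)) := by
  -- The barycentric identities are affine, so they extend to the affine span; there only the open
  -- conditions π y i > 0 remain.
  have hspan : ∀ y ∈ affineSpan ℝ (convexHull ℝ (Set.range p)),
      ∑ i, π y i = 1 ∧ ∑ i, π y i • p i = y := by
    intro y hy
    refine affineSpan_induction (p := fun y => ∑ i, π y i = 1 ∧ ∑ i, π y i • p i = y) hy ?_ ?_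
    · exact fun y hy => ((mem_convexHull_range_iff_of_dual hπ y).mp hy).2
    · rintro c u v w ⟨hu1, hu2⟩ ⟨hv1, hv2⟩ ⟨hw1, hw2⟩
      simp only [vsub_eq_sub, vadd_eq_add, map_add, map_smul, map_sub, Pi.add_apply, Pi.smul_apply,
        Pi.sub_apply, smul_eq_mul, add_smul, mul_smul, sub_smul, Finset.sum_add_distrib,
        Finset.sum_sub_distrib, ← Finset.smul_sum, ← Finset.mul_sum, hu1, hu2, hv1, hv2, hw1, hw2]
      simp
  have hcont : Continuous fun y : Fin n → ℝ => π y := π.continuous_of_finiteDimensional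
  refine ⟨⟨x, subset_affineSpan ℝ _ hx⟩, ?_, rfl⟩
  refine mem_interior.mpr ⟨{y | ∀ i, 0 < π (y : Fin n → ℝ) i}, ?_, ?_, hpos⟩
  · intro y hy
    exact (mem_convexHull_range_iff_of_dual hπ _).mpr ⟨fun i => (hy i).le, hspan _ y.2⟩
  · simp only [Set.ofPred_forall]
    exact isOpen_iInter_of_finite fun i => isOpen_lt continuous_const
      ((continuous_apply i).comp (hcont.comp continuous_subtype_val))

lemma exists_dual_of_linearIndependent {n k : ℕ} {p : Fin k → Fin n → ℝ}
    (hp : LinearIndependent ℝ p) :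
    ∃ π : (Fin n → ℝ) →ₗ[ℝ] (Fin k → ℝ), ∀ i, π (p i) = Pi.single i 1 := by
  obtain ⟨π, hπ⟩ := (Fintype.linearCombination ℝ p).exists_leftInverse_of_injective
    (LinearMap.ker_eq_bot.mpr (linearIndependent_iff_injective_fintypeLinearCombination.mp hp))
  refine ⟨π, fun i => ?_⟩
  have := LinearMap.congr_fun hπ (Pi.single i 1)
  simpa [Fintype.linearCombination_apply_single] using this

/-! ### Rigid simplices and their circuit forms -/

/-- Exponents `a i` of degree `d` and an exponent `β` such that `β` is the barycenter of the
simplex with vertices `2 • a i`, and `β` is not a sum of two different exponents from the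
convex hull of the `a i`. -/
structure IsRigidSimplex {n k : ℕ} (d : ℕ) (a : Fin k → Fin n →₀ ℕ) (β : Fin n →₀ ℕ) : Prop where
  pos : 0 < k
  degree_eq : ∀ i, (a i).degree = d
  nsmul_eq : k • β = ∑ i, 2 • a i
  ne : ∀ i, 2 • a i ≠ β
  linearIndependent : LinearIndependent ℝ fun i => toPoint (a i)
  -- The convex hull enters through upper bounds on natural weights, the form that
  -- `weight_le_of_sum_sq` delivers.
  rigid : ∀ γ γ', γ + γ' = β → (∀ (w : Fin n → ℕ) (c : ℕ), (∀ i, Finsupp.weight w (a i) ≤ c) →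
    Finsupp.weight w γ ≤ c ∧ Finsupp.weight w γ' ≤ c) → γ = γ'

/-- The circuit form `∑ x ^ (2 a i) - k x ^ β`. -/
noncomputable def simplexForm {n k : ℕ} (a : Fin k → Fin n →₀ ℕ) (β : Fin n →₀ ℕ) :
    MvPolynomial (Fin n) ℝ :=
  ∑ i, monomial (2 • a i) 1 - monomial β (k : ℝ)

lemma eval_simplexForm {n k : ℕ} (a : Fin k → Fin n →₀ ℕ) (β : Fin n →₀ ℕ) (x : Fin n → ℝ) :
    eval x (simplexForm a β) = ∑ i, mono x (a i) ^ 2 - k * mono x β := by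
  simp only [simplexForm, map_sub, map_sum, eval_monomial_eq_mono, mono_nsmul, one_mul]

lemma toPoint_nsmul {n : ℕ} (m : ℕ) (α : Fin n →₀ ℕ) : toPoint (m • α) = (m : ℝ) • toPoint α := by
  ext; simp [toPoint]

lemma toPoint_sum {n : ℕ} {ι : Type*} (s : Finset ι) (α : ι → Fin n →₀ ℕ) :
    toPoint (∑ i ∈ s, α i) = ∑ i ∈ s, toPoint (α i) := by
  ext; simp [toPoint]

namespace IsRigidSimplex

variable {n k d : ℕ} {a : Fin k → Fin n →₀ ℕ} {β : Fin n →₀ ℕ}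

lemma injective (h : IsRigidSimplex d a β) : Function.Injective a := fun i j hij =>
  h.linearIndependent.injective (by simp only [hij])

lemma two_nsmul_inj (h : IsRigidSimplex d a β) {i j : Fin k} : 2 • a i = 2 • a j ↔ i = j :=
  ⟨fun hij => h.injective (nsmul_right_injective two_ne_zero hij), fun hij => by rw [hij]⟩

lemma weight_le (h : IsRigidSimplex d a β) {w : Fin n → ℕ} {c : ℕ}
    (hw : ∀ i, Finsupp.weight w (a i) ≤ c) : Finsupp.weight w β ≤ 2 * c := by
  have h1 := congrArg (Finsupp.weight w) h.nsmul_eq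
  simp only [map_nsmul, map_sum, smul_eq_mul] at h1
  have h2 : ∑ i, 2 * Finsupp.weight w (a i) ≤ ∑ _i : Fin k, 2 * c :=
    Finset.sum_le_sum fun i _ => Nat.mul_le_mul_left 2 (hw i)
  rw [← h1, Finset.sum_const, Finset.card_univ, Fintype.card_fin, smul_eq_mul] at h2
  exact Nat.le_of_mul_le_mul_left h2 h.pos

lemma add_ne (h : IsRigidSimplex d a β) (i j : Fin k) : a i + a j ≠ β := by
  intro hij
  have h1 := h.rigid _ _ hij fun w c hw => ⟨hw i, hw j⟩
  exact h.ne i (by rw [two_nsmul]; nth_rw 2 [h1]; exact hij)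

lemma degree_base (h : IsRigidSimplex d a β) : β.degree = 2 * d := by
  have h1 := congrArg Finsupp.degree h.nsmul_eq
  simp only [map_nsmul, map_sum, smul_eq_mul, h.degree_eq, Finset.sum_const, Finset.card_univ,
    Fintype.card_fin] at h1
  exact Nat.eq_of_mul_eq_mul_left h.pos h1

lemma simplexForm_mem_forms (h : IsRigidSimplex d a β) : simplexForm a β ∈ Forms n (2 * d) := by
  refine Submodule.sub_mem _ (Submodule.sum_mem _ fun i _ => ?_) ?_
  · exact isHomogeneous_monomial _ (by rw [map_nsmul, h.degree_eq, smul_eq_mul])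
  · exact isHomogeneous_monomial _ h.degree_base

lemma simplexForm_mem_PSD (h : IsRigidSimplex d a β) : simplexForm a β ∈ PSD n d := by
  refine ⟨h.simplexForm_mem_forms, fun x => ?_⟩
  rw [eval_simplexForm, sub_nonneg]
  have hk : (0 : ℝ) < k := Nat.cast_pos.mpr h.pos
  -- The barycenter relation identifies the geometric mean in AM-GM as |x^β|.
  have hprod : ∏ i, mono x (a i) ^ 2 = |mono x β| ^ k := by
    have h1 := congrArg (mono x) h.nsmul_eq
    rw [mono_nsmul, mono_sum] at h1
    simp only [mono_nsmul] at h1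
    rw [← abs_pow, h1, abs_of_nonneg (Finset.prod_nonneg fun i _ => sq_nonneg _)]
  have h2 := Real.geom_mean_le_arith_mean Finset.univ (fun _ : Fin k => (1 : ℝ))
    (fun i => mono x (a i) ^ 2) (fun _ _ => zero_le_one) (by simpa using h.pos)
    (fun i _ => sq_nonneg _)
  simp only [Real.rpow_one, hprod, Finset.sum_const, Finset.card_univ, Fintype.card_fin,
    nsmul_eq_mul, mul_one, one_mul] at h2
  rw [Real.pow_rpow_inv_natCast (abs_nonneg _) h.pos.ne', le_div_iff₀ hk] at h2
  nlinarith [le_abs_self (mono x β)]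

lemma coeff_base (h : IsRigidSimplex d a β) : (simplexForm a β).coeff β = -k := by
  classical
  simp [simplexForm, coeff_sum, coeff_monomial, h.ne]

lemma coeff_vertex (h : IsRigidSimplex d a β) (i : Fin k) :
    (simplexForm a β).coeff (2 • a i) = 1 := by
  classical
  simp [simplexForm, coeff_sum, coeff_monomial, (h.ne i).symm, h.two_nsmul_inj]

lemma coeff_of_ne {γ : Fin n →₀ ℕ} (h1 : ∀ i, 2 • a i ≠ γ) (h2 : β ≠ γ) :
    (simplexForm a β).coeff γ = 0 := by
  classical
  simp [simplexForm, coeff_sum, coeff_monomial, h1, h2]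

lemma support_simplexForm (h : IsRigidSimplex d a β) :
    ((simplexForm a β).support : Set (Fin n →₀ ℕ)) = insert β (Set.range fun i => 2 • a i) := by
  ext γ
  simp only [Finset.mem_coe, mem_support_iff, Set.mem_insert_iff, Set.mem_range]
  constructor
  · intro hγ
    by_contra! hne
    exact hγ (coeff_of_ne hne.2 hne.1.symm)
  · rintro (rfl | ⟨i, rfl⟩)
    · rw [h.coeff_base]
      exact neg_ne_zero.mpr (Nat.cast_ne_zero.mpr h.pos.ne')
    · rw [h.coeff_vertex]
      exact one_ne_zero

lemma squareExponents_simplexForm (h : IsRigidSimplex d a β) :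
    squareExponents (simplexForm a β) = Set.range fun i => 2 • a i := by
  ext γ
  constructor
  · rintro ⟨h1, -, h3⟩
    have h1' : γ ∈ ((simplexForm a β).support : Set (Fin n →₀ ℕ)) := h1
    rw [h.support_simplexForm] at h1'
    rcases h1' with rfl | h1'
    · rw [h.coeff_base] at h3
      have : (0 : ℝ) ≤ k := Nat.cast_nonneg k
      linarith
    · exact h1'
  · rintro ⟨i, rfl⟩
    refine ⟨?_, fun j => ?_, ?_⟩
    · rw [mem_support_iff, h.coeff_vertex]
      exact one_ne_zero
    · simp
    · rw [h.coeff_vertex]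
      exact one_pos

lemma innerExponents_simplexForm (h : IsRigidSimplex d a β) :
    innerExponents (simplexForm a β) = {β} := by
  rw [innerExponents, h.squareExponents_simplexForm, h.support_simplexForm,
    Set.insert_sdiff_of_notMem, Set.sdiff_self]
  · simp
  · rintro ⟨i, hi⟩
    exact h.ne i hi

lemma isCircuit_simplexForm (h : IsRigidSimplex d a β) : IsCircuit n d (simplexForm a β) := by
  let p : Fin k → Fin n → ℝ := fun i => toPoint (2 • a i)
  have hk : (k : ℝ) ≠ 0 := Nat.cast_ne_zero.mpr h.pos.ne'
  obtain ⟨π, hπ⟩ : ∃ π : (Fin n → ℝ) →ₗ[ℝ] (Fin k → ℝ), ∀ i, π (p i) = Pi.single i 1 := by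
    obtain ⟨π, hπ⟩ := exists_dual_of_linearIndependent h.linearIndependent
    refine ⟨(2 : ℝ)⁻¹ • π, fun i => ?_⟩
    simp [p, toPoint_nsmul, hπ]
  have hβ : toPoint β = ∑ i, (k : ℝ)⁻¹ • p i := by
    have h1 := congrArg toPoint h.nsmul_eq
    rw [toPoint_nsmul, toPoint_sum] at h1
    rw [← Finset.smul_sum, ← h1, inv_smul_smul₀ hk]
  have hβmem : toPoint β ∈ convexHull ℝ (Set.range p) := by
    rw [hβ]
    refine (convex_convexHull ℝ _).sum_mem (fun i _ => by positivity) ?_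
      fun i _ => subset_convexHull ℝ _ ⟨i, rfl⟩
    simp [hk]
  have hnewton : newton (simplexForm a β) = convexHull ℝ (Set.range p) := by
    rw [newton, h.support_simplexForm, Set.image_insert_eq, ← Set.range_comp]
    refine Set.Subset.antisymm (convexHull_min ?_ (convex_convexHull ℝ _))
      (convexHull_mono (Set.subset_insert _ _))
    exact Set.insert_subset hβmem (subset_convexHull ℝ _)
  have hvert : vertices (simplexForm a β) = Set.range p := by
    rw [vertices, hnewton, extremePoints_convexHull_range_of_dual hπ]
  have hp : AffineIndependent ℝ p := by
    rw [affineIndependent_iff]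
    intro s w _ hw j hj
    have h1 := congrFun (congrArg π hw) j
    simpa [hπ, Pi.single_apply, hj] using h1
  refine ⟨h.simplexForm_mem_forms, ?_, ?_, Or.inl ⟨β, h.innerExponents_simplexForm, ?_⟩⟩
  · rw [h.squareExponents_simplexForm, hvert, ← Set.range_comp]
    rfl
  · rw [hvert]
    exact hp.range
  · rw [hnewton]
    refine mem_intrinsicInterior_convexHull_range_of_dual hπ hβmem fun i => ?_
    have : π (toPoint β) i = (k : ℝ)⁻¹ := by simp [hβ, hπ, Pi.single_apply]
    rw [this]
    exact inv_pos.mpr (Nat.cast_pos.mpr h.pos)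

/-- A form whose support is in the span of the `x ^ (a i + a j)` and `x ^ β`, with a negative
coefficient at `β`, is not a sum of squares. -/
theorem notMem_SOS (h : IsRigidSimplex d a β) {f : MvPolynomial (Fin n) ℝ}
    (hf : ∀ γ ∈ f.support, γ = β ∨ ∃ i j, γ = a i + a j) (hneg : f.coeff β < 0) : f ∉ SOS n d := by
  classical
  rintro ⟨-, s, -, g, -, rfl⟩
  refine hneg.not_ge ?_
  rw [coeff_sum]
  refine Finset.sum_nonneg fun l _ => ?_
  rw [sq, coeff_mul]
  refine Finset.sum_nonneg fun ⟨γ, γ'⟩ hγ => ?_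
  rw [Finset.HasAntidiagonal.mem_antidiagonal] at hγ
  by_cases h1 : γ ∈ (g l).support
  · by_cases h2 : γ' ∈ (g l).support
    · have heq : γ = γ' := by
        refine h.rigid _ _ hγ fun w c hw => ?_
        have hle := weight_le_of_sum_sq w c g (fun δ hδ => ?_) l
        · exact ⟨hle _ h1, hle _ h2⟩
        · rcases hf δ hδ with rfl | ⟨i, j, rfl⟩
          · exact h.weight_le hw
          · rw [map_add, two_mul]
            exact add_le_add (hw i) (hw j)
      rw [heq]
      exact mul_self_nonneg _
    · simp [notMem_support_iff.mp h2]
  · simp [notMem_support_iff.mp h1]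

lemma exists_of_mem_support_simplexForm (h : IsRigidSimplex d a β) :
    ∀ γ ∈ (simplexForm a β).support, γ = β ∨ ∃ i j, γ = a i + a j := by
  intro γ hγ
  have h1 : γ ∈ ((simplexForm a β).support : Set (Fin n →₀ ℕ)) := hγ
  rw [h.support_simplexForm] at h1
  rcases h1 with h1 | ⟨i, rfl⟩
  · exact Or.inl h1
  · exact Or.inr ⟨i, i, two_nsmul _⟩

theorem simplexForm_notMem_SOS (h : IsRigidSimplex d a β) : simplexForm a β ∉ SOS n d := by
  refine h.notMem_SOS h.exists_of_mem_support_simplexForm ?_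
  rw [h.coeff_base]
  exact neg_neg_of_pos (Nat.cast_pos.mpr h.pos)

/-- Adding a suitable square to the circuit form yields a form that is neither SOS nor SONC. -/
theorem exists_mem_SOSplusSONC_notMem (h : IsRigidSimplex d a β) {i₀ i₁ i₂ : Fin k}
    (h02 : i₀ ≠ i₂) (h12 : i₁ ≠ i₂) (hodd : ¬ ∀ i, Even ((a i₀ + a i₁) i)) :
    ∃ f ∈ SOSplusSONC n d, f ∉ SOS n d ∧ f ∉ SONC n d := by
  classical
  -- The minus sign keeps q(1) = 1 while q² has coefficient 2 at a i₀ + a i₁; the circuit form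
  -- contributes 0 to both, so the SONC inequality would read 1 - 4 ≥ 0.
  let q : MvPolynomial (Fin n) ℝ := monomial (a i₀) 1 + monomial (a i₁) 1 - monomial (a i₂) 1
  have hq : q ∈ Forms n d := Submodule.sub_mem _ (Submodule.add_mem _
    (isHomogeneous_monomial _ (h.degree_eq _)) (isHomogeneous_monomial _ (h.degree_eq _)))
    (isHomogeneous_monomial _ (h.degree_eq _))
  have hqsos : q ^ 2 ∈ SOS n d := by
    refine ⟨?_, 1, one_pos, fun _ => q, fun _ => hq, by simp⟩
    have := IsHomogeneous.pow hq 2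
    rwa [mul_comm] at this
  have hq2 : q ^ 2 = monomial (2 • a i₀) 1 + monomial (2 • a i₁) 1 + monomial (2 • a i₂) 1
      + monomial (a i₀ + a i₁) 2 - monomial (a i₀ + a i₂) 2 - monomial (a i₁ + a i₂) 2 := by
    have hm : ∀ i j, (monomial (a i + a j) (2 : ℝ)) = 2 * (monomial (a i) 1 * monomial (a j) 1) := by
      intro i j
      rw [monomial_mul, mul_one, two_mul, ← map_add, one_add_one_eq_two]
    have hs : ∀ i, (monomial (2 • a i) (1 : ℝ)) = monomial (a i) 1 ^ 2 := by
      intro i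
      rw [monomial_pow, one_pow]
    simp only [q, hm, hs]
    ring
  have hcoeff : ∀ γ, (∀ i j, a i + a j ≠ γ) → (q ^ 2).coeff γ = 0 := by
    intro γ hγ
    have hγ' : ∀ i, 2 • a i ≠ γ := fun i => by rw [two_nsmul]; exact hγ i i
    simp [hq2, coeff_monomial, hγ, hγ']
  have hodd' : ∀ i, 2 • a i ≠ a i₀ + a i₁ := by
    intro i hi
    rw [← hi] at hodd
    exact hodd fun j => by simp
  refine ⟨q ^ 2 + simplexForm a β,
    ⟨q ^ 2, hqsos, _, mem_SONC_of_isCircuit h.isCircuit_simplexForm h.simplexForm_mem_PSD, rfl⟩,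
    h.notMem_SOS ?_ ?_, fun hmem => ?_⟩
  · intro γ hγ
    by_contra! hne
    refine mem_support_iff.mp hγ ?_
    rw [coeff_add, hcoeff γ fun i j => (hne.2 i j).symm,
      coeff_of_ne (fun i => by rw [two_nsmul]; exact (hne.2 i i).symm) hne.1.symm, add_zero]
  · rw [coeff_add, hcoeff β h.add_ne, zero_add, h.coeff_base]
    exact neg_neg_of_pos (Nat.cast_pos.mpr h.pos)
  · have h1 := SONC.eval_one_sub_two_mul_coeff_nonneg hmem hodd
    have h2 : (q ^ 2).coeff (a i₀ + a i₁) = 2 := by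
      have e1 : a i₀ + a i₂ ≠ a i₀ + a i₁ := fun e => h12 (h.injective (add_left_cancel e)).symm
      have e2 : a i₁ + a i₂ ≠ a i₀ + a i₁ := fun e => by
        rw [add_comm (a i₀)] at e
        exact h02 (h.injective (add_left_cancel e)).symm
      simp [hq2, coeff_monomial, hodd', e1, e2]
    have h3 : eval 1 (q ^ 2) = 1 := by
      simp [q, eval_monomial_eq_mono, mono_one]
    rw [map_add, coeff_add, h2, h3, eval_simplexForm, coeff_of_ne hodd' (h.add_ne _ _).symm] at h1
    simp only [mono_one, one_pow, Finset.sum_const, Finset.card_univ, Fintype.card_fin,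
      nsmul_eq_mul, mul_one, sub_self] at h1
    norm_num at h1

end IsRigidSimplex
-- Moving zeros by linear substitutions
/-- The linear substitution `x ↦ x + (c * (x i - x j)) • v`. -/
noncomputable def shear {n : ℕ} (i j : Fin n) (c : ℝ) (v : Fin n → ℝ) :
    MvPolynomial (Fin n) ℝ →ₐ[ℝ] MvPolynomial (Fin n) ℝ :=
  aeval fun l => X l + C (c * v l) * (X i - X j)

lemma shear_mem_forms {n m : ℕ} (i j : Fin n) (c : ℝ) (v : Fin n → ℝ)
    {f : MvPolynomial (Fin n) ℝ} (hf : f ∈ Forms n m) : shear i j c v f ∈ Forms n m := by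
  have h := IsHomogeneous.aeval (n := 1) (φ := f) (m := m) hf
    (fun l => X l + C (c * v l) * (X i - X j)) fun l =>
      (isHomogeneous_X ℝ l).add (((isHomogeneous_X ℝ i).sub (isHomogeneous_X ℝ j)).C_mul _)
  rwa [one_mul] at h

lemma eval_shear {n : ℕ} (i j : Fin n) (c : ℝ) (v x : Fin n → ℝ) (f : MvPolynomial (Fin n) ℝ) :
    eval x (shear i j c v f) = eval (fun l => x l + c * v l * (x i - x j)) f := by
  simp only [shear, aeval_def, eval₂_eq', map_sum, map_mul, map_prod, map_pow, map_add, map_sub,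
    eval_X, eval_C, algebraMap_eq]
  rw [eval_eq']

lemma shear_mem_SOS {n d : ℕ} (i j : Fin n) (c : ℝ) (v : Fin n → ℝ)
    {f : MvPolynomial (Fin n) ℝ} (hf : f ∈ SOS n d) : shear i j c v f ∈ SOS n d := by
  obtain ⟨hf, s, hs, g, hg, rfl⟩ := hf
  exact ⟨shear_mem_forms _ _ _ _ hf, s, hs, fun l => shear i j c v (g l),
    fun l => shear_mem_forms _ _ _ _ (hg l), by simp⟩

lemma shear_mem_PSD {n d : ℕ} (i j : Fin n) (c : ℝ) (v : Fin n → ℝ)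
    {f : MvPolynomial (Fin n) ℝ} (hf : f ∈ PSD n d) : shear i j c v f ∈ PSD n d :=
  ⟨shear_mem_forms _ _ _ _ hf.1, fun x => by rw [eval_shear]; exact hf.2 _⟩

/-- The hypothesis on b and c says that the two shears are mutually inverse; this is what transfers
non-SOS to the sheared form. -/
lemma shear_shear {n : ℕ} (i j : Fin n) (b c : ℝ) (v : Fin n → ℝ)
    (h : b + c + b * c * (v i - v j) = 0) (f : MvPolynomial (Fin n) ℝ) :
    shear i j b v (shear i j c v f) = f := by
  refine MvPolynomial.funext fun x => ?_
  rw [eval_shear, eval_shear]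
  congr 2
  ext l
  linear_combination v l * (x i - x j) * h

/-- A PSD form that is not SOS and vanishes at the all-ones vector and at a nonconstant vector can
be transformed into a PSD form that is not SOS+SONC. -/
theorem exists_mem_PSD_notMem_SOSplusSONC {n d : ℕ} {f : MvPolynomial (Fin n) ℝ}
    (hf : f ∈ PSD n d) (hsos : f ∉ SOS n d) (h1 : eval 1 f = 0) {z : Fin n → ℝ}
    (hz : eval z f = 0) {i j : Fin n} (hij : z i ≠ z j) : ∃ g ∈ PSD n d, g ∉ SOSplusSONC n d := by
  obtain ⟨r, hr0, hr, hr2⟩ := exists_injective_mono n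
  have hq : r i ^ 2 - r j ^ 2 ≠ 0 := sub_ne_zero.mpr fun h => hij (congrArg z (hr2 h))
  have hz' : z i - z j ≠ 0 := sub_ne_zero.mpr hij
  -- With c = (r i² - r j²)⁻¹ the shear sends r² to z and fixes 1. Its inverse has constant -(z i -
  -- z j)⁻¹.
  let v : Fin n → ℝ := fun l => z l - r l ^ 2
  refine ⟨shear i j (r i ^ 2 - r j ^ 2)⁻¹ v f, shear_mem_PSD _ _ _ _ hf, fun hmem => hsos ?_⟩
  have h := mem_SOS_of_two_zeros hmem hr0 hr ?_ ?_
  · rw [← shear_shear i j (-(z i - z j)⁻¹) (r i ^ 2 - r j ^ 2)⁻¹ v _ f]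
    · exact shear_mem_SOS _ _ _ _ h
    · simp only [v]
      field_simp
      ring
  · rw [eval_shear]
    simpa [Pi.one_def] using h1
  · rw [eval_shear, ← hz]
    congr 2
    ext l
    simp only [v]
    field_simp
    ring

theorem IsRigidSimplex.ssubset {n k d : ℕ} {a : Fin k → Fin n →₀ ℕ} {β : Fin n →₀ ℕ}
    (h : IsRigidSimplex d a β) {i₀ i₁ i₂ : Fin k} (h02 : i₀ ≠ i₂) (h12 : i₁ ≠ i₂)
    (hodd : ¬ ∀ i, Even ((a i₀ + a i₁) i)) {σ : Fin n → ℝ} (hσ : ∀ i, σ i ^ 2 = 1)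
    (hσβ : mono σ β = 1) {i j : Fin n} (hij : σ i ≠ σ j) :
    SOS n d ∪ SONC n d ⊂ SOSplusSONC n d ∧ SOSplusSONC n d ⊂ PSD n d := by
  obtain ⟨f, hf, hf1, hf2⟩ := h.exists_mem_SOSplusSONC_notMem h02 h12 hodd
  have h1 : eval 1 (simplexForm a β) = 0 := by simp [eval_simplexForm, mono_one]
  have h2 : eval σ (simplexForm a β) = 0 := by
    simp [eval_simplexForm, hσβ, ← mono_sq, hσ, ← Pi.one_def, mono_one]
  obtain ⟨g, hg, hg'⟩ := exists_mem_PSD_notMem_SOSplusSONC h.simplexForm_mem_PSD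
    h.simplexForm_notMem_SOS h1 h2 hij
  exact ⟨⟨SOS_union_SONC_subset n d, fun hsub => (hsub hf).elim hf1 hf2⟩,
    ⟨SOSplusSONC_subset_PSD n d, fun hsub => hg' (hsub hg)⟩⟩

/-! ### The Motzkin and Choi-Lam simplices -/

/-- The function on `Fin (m + 3)` with the given first three values, extended by zero. -/
def cons3 {m : ℕ} (p q r : ℕ) : Fin (m + 3) → ℕ := Fin.cons p (Fin.cons q (Fin.cons r 0))

/-- The function on `Fin (m + 4)` with the given first four values, extended by zero. -/
def cons4 {m : ℕ} (p q r s : ℕ) : Fin (m + 4) → ℕ :=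
  Fin.cons p (Fin.cons q (Fin.cons r (Fin.cons s 0)))

/-- The exponent of a monomial in the first three variables. -/
noncomputable def exp3 {m : ℕ} (p q r : ℕ) : Fin (m + 3) →₀ ℕ :=
  Finsupp.equivFunOnFinite.symm (cons3 p q r)

/-- The exponent of a monomial in the first four variables. -/
noncomputable def exp4 {m : ℕ} (p q r s : ℕ) : Fin (m + 4) →₀ ℕ :=
  Finsupp.equivFunOnFinite.symm (cons4 p q r s)

lemma eq_exp3_iff {m : ℕ} {γ : Fin (m + 3) →₀ ℕ} {p q r : ℕ} :
    γ = exp3 p q r ↔ γ 0 = p ∧ γ 1 = q ∧ γ 2 = r ∧ ∀ i : Fin m, γ i.succ.succ.succ = 0 := by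
  simp [Finsupp.ext_iff, Fin.forall_fin_succ (n := _ + 2), Fin.forall_fin_succ (n := _ + 1),
    Fin.forall_fin_succ (n := m), exp3, cons3]

lemma eq_exp4_iff {m : ℕ} {γ : Fin (m + 4) →₀ ℕ} {p q r s : ℕ} :
    γ = exp4 p q r s ↔ γ 0 = p ∧ γ 1 = q ∧ γ 2 = r ∧ γ 3 = s ∧
      ∀ i : Fin m, γ i.succ.succ.succ.succ = 0 := by
  simp [Finsupp.ext_iff, Fin.forall_fin_succ (n := _ + 3), Fin.forall_fin_succ (n := _ + 2),
    Fin.forall_fin_succ (n := _ + 1), Fin.forall_fin_succ (n := m), exp4, cons4,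
    show (Fin.succ 2 : Fin (m + 4)) = 3 from rfl]

lemma exp3_apply {m : ℕ} (p q r : ℕ) : (exp3 p q r : Fin (m + 3) →₀ ℕ) 0 = p ∧
    (exp3 p q r : Fin (m + 3) →₀ ℕ) 1 = q ∧ (exp3 p q r : Fin (m + 3) →₀ ℕ) 2 = r ∧
    ∀ i : Fin m, (exp3 p q r : Fin (m + 3) →₀ ℕ) i.succ.succ.succ = 0 := eq_exp3_iff.mp rfl

lemma exp4_apply {m : ℕ} (p q r s : ℕ) : (exp4 p q r s : Fin (m + 4) →₀ ℕ) 0 = p ∧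
    (exp4 p q r s : Fin (m + 4) →₀ ℕ) 1 = q ∧ (exp4 p q r s : Fin (m + 4) →₀ ℕ) 2 = r ∧
    (exp4 p q r s : Fin (m + 4) →₀ ℕ) 3 = s ∧
    ∀ i : Fin m, (exp4 p q r s : Fin (m + 4) →₀ ℕ) i.succ.succ.succ.succ = 0 := eq_exp4_iff.mp rfl

lemma weight_cons3 {m : ℕ} (p q r : ℕ) (γ : Fin (m + 3) →₀ ℕ) :
    Finsupp.weight (cons3 p q r) γ = γ 0 * p + γ 1 * q + γ 2 * r := by
  simp [Finsupp.weight_apply, Finsupp.sum_fintype, Fin.sum_univ_succ (n := _ + 2),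
    Fin.sum_univ_succ (n := _ + 1), Fin.sum_univ_succ (n := m), cons3, add_assoc]

lemma weight_cons4 {m : ℕ} (p q r s : ℕ) (γ : Fin (m + 4) →₀ ℕ) :
    Finsupp.weight (cons4 p q r s) γ = γ 0 * p + γ 1 * q + γ 2 * r + γ 3 * s := by
  simp [Finsupp.weight_apply, Finsupp.sum_fintype, Fin.sum_univ_succ (n := _ + 3),
    Fin.sum_univ_succ (n := _ + 2), Fin.sum_univ_succ (n := _ + 1), Fin.sum_univ_succ (n := m),
    cons4, add_assoc, show (Fin.succ 2 : Fin (m + 4)) = 3 from rfl]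

lemma degree_exp3 {m : ℕ} (p q r : ℕ) :
    (exp3 p q r : Fin (m + 3) →₀ ℕ).degree = p + q + r := by
  simp [Finsupp.degree_eq_sum, Fin.sum_univ_succ (n := _ + 2), Fin.sum_univ_succ (n := _ + 1),
    Fin.sum_univ_succ (n := m), exp3, cons3, add_assoc]

lemma degree_exp4 {m : ℕ} (p q r s : ℕ) :
    (exp4 p q r s : Fin (m + 4) →₀ ℕ).degree = p + q + r + s := by
  simp [Finsupp.degree_eq_sum, Fin.sum_univ_succ (n := _ + 3), Fin.sum_univ_succ (n := _ + 2),
    Fin.sum_univ_succ (n := _ + 1), Fin.sum_univ_succ (n := m), exp4, cons4, add_assoc]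

/-- The half exponents of the Motzkin form, multiplied by `z ^ l`. -/
noncomputable def motzkin {m : ℕ} (l : ℕ) : Fin 3 → Fin (m + 3) →₀ ℕ :=
  ![exp3 2 1 l, exp3 1 2 l, exp3 0 0 (l + 3)]

/-- The half exponents of the Choi-Lam form. -/
noncomputable def choiLam {m : ℕ} : Fin 4 → Fin (m + 4) →₀ ℕ :=
  ![exp4 1 1 0 0, exp4 0 1 1 0, exp4 1 0 1 0, exp4 0 0 0 2]

lemma isRigidSimplex_motzkin (m l : ℕ) :
    IsRigidSimplex (l + 3) (motzkin (m := m) l) (exp3 2 2 (2 * l + 2)) where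
  pos := by norm_num
  degree_eq i := by
    fin_cases i <;> simp [motzkin, degree_exp3] <;> omega
  nsmul_eq := by
    have h : (3 • exp3 2 2 (2 * l + 2) : Fin (m + 3) →₀ ℕ) = exp3 6 6 (6 * l + 6) := by
      simp [eq_exp3_iff, exp3_apply]
      omega
    rw [h, eq_comm, eq_exp3_iff]
    simp [Fin.sum_univ_three, motzkin, exp3_apply]
    omega
  ne i := by
    fin_cases i <;> simp [motzkin, eq_exp3_iff, exp3_apply]
  linearIndependent := by
    rw [Fintype.linearIndependent_iff]
    intro g hg
    have h0 := congrFun hg 0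
    have h1 := congrFun hg 1
    have h2 := congrFun hg 2
    simp [Fin.sum_univ_three, motzkin, toPoint, exp3_apply] at h0 h1 h2
    have e0 : g 0 = 0 := by linarith
    have e1 : g 1 = 0 := by linarith
    have e2 : g 2 = 0 := by
      rw [e0, e1] at h2
      have : (l : ℝ) + 3 ≠ 0 := by positivity
      simpa [this] using h2
    intro i
    fin_cases i <;> assumption
  rigid γ γ' hadd hw := by
    obtain ⟨h0, h1, h2, h3⟩ := eq_exp3_iff.mp hadd
    -- The degree bounds add up to equality, so the next two weights give γ 0 ≤ 2 γ 1 and γ 1 ≤ 2 γ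
    -- 0. With γ 0 + γ 1 ≤ 3, likewise for γ', the pair (2, 2) splits only as (1, 1) + (1, 1).
    have w1 := hw (cons3 1 1 1) (l + 3)
    have w2 := hw (cons3 3 0 2) (2 * l + 6)
    have w3 := hw (cons3 0 3 2) (2 * l + 6)
    have w4 := hw (cons3 1 1 0) 3
    simp only [weight_cons3, Fin.forall_fin_succ, motzkin, Matrix.cons_val_zero,
      Matrix.cons_val_succ, exp3_apply, Finsupp.add_apply] at w1 w2 w3 w4 h0 h1 h2 h3
    have e1 := w1 ⟨by omega, by omega, by omega, fun i => i.elim0⟩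
    have e2 := w2 ⟨by omega, by omega, by omega, fun i => i.elim0⟩
    have e3 := w3 ⟨by omega, by omega, by omega, fun i => i.elim0⟩
    have e4 := w4 ⟨by omega, by omega, by omega, fun i => i.elim0⟩
    rw [eq_exp3_iff.mpr ⟨rfl, rfl, rfl, fun i => (Nat.add_eq_zero_iff.mp (h3 i)).1⟩, eq_comm,
      eq_exp3_iff]
    exact ⟨by omega, by omega, by omega, fun i => (Nat.add_eq_zero_iff.mp (h3 i)).2⟩

lemma isRigidSimplex_choiLam (m : ℕ) :
    IsRigidSimplex 2 (choiLam (m := m)) (exp4 1 1 1 1) where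
  pos := by norm_num
  degree_eq i := by
    fin_cases i <;> simp [choiLam, degree_exp4]
  nsmul_eq := by
    have h : (4 • exp4 1 1 1 1 : Fin (m + 4) →₀ ℕ) = exp4 4 4 4 4 := by
      simp [eq_exp4_iff, exp4_apply]
    rw [h, eq_comm, eq_exp4_iff]
    simp [Fin.sum_univ_four, choiLam, exp4_apply]
  ne i := by
    fin_cases i <;> simp [choiLam, eq_exp4_iff, exp4_apply]
  linearIndependent := by
    rw [Fintype.linearIndependent_iff]
    intro g hg
    have h0 := congrFun hg 0
    have h1 := congrFun hg 1
    have h2 := congrFun hg 2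
    have h3 := congrFun hg 3
    simp [Fin.sum_univ_four, choiLam, toPoint, exp4_apply] at h0 h1 h2 h3
    have e0 : g 0 = 0 := by linarith
    have e1 : g 1 = 0 := by linarith
    have e2 : g 2 = 0 := by linarith
    intro i
    fin_cases i <;> assumption
  rigid γ γ' hadd hw := by
    obtain ⟨h0, h1, h2, h3, h4⟩ := eq_exp4_iff.mp hadd
    -- No splitting exists: the part containing the fourth variable has no other variable by the
    -- last three weights, so its degree is 1 instead of 2.
    have w1 := hw (cons4 1 1 1 1) 2
    have w2 := hw (cons4 2 0 0 1) 2
    have w3 := hw (cons4 0 2 0 1) 2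
    have w4 := hw (cons4 0 0 2 1) 2
    simp only [weight_cons4, Fin.forall_fin_succ, choiLam, Matrix.cons_val_zero,
      Matrix.cons_val_succ, exp4_apply, Finsupp.add_apply] at w1 w2 w3 w4 h0 h1 h2 h3 h4
    have e1 := w1 ⟨by omega, by omega, by omega, by omega, fun i => i.elim0⟩
    have e2 := w2 ⟨by omega, by omega, by omega, by omega, fun i => i.elim0⟩
    have e3 := w3 ⟨by omega, by omega, by omega, by omega, fun i => i.elim0⟩
    have e4 := w4 ⟨by omega, by omega, by omega, by omega, fun i => i.elim0⟩
    omega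

/-- The sign vector that is negative exactly in the first two coordinates. -/
def signVector (m : ℕ) : Fin (m + 3) → ℝ := Fin.cons (-1) (Fin.cons (-1) 1)

lemma signVector_sq (m : ℕ) (i : Fin (m + 3)) : signVector m i ^ 2 = 1 := by
  refine Fin.cases ?_ (fun i => Fin.cases ?_ (fun i => ?_) i) i <;> simp [signVector]

lemma signVector_ne (m : ℕ) : signVector m 0 ≠ signVector m 2 := by
  have : signVector m 2 = 1 := rfl
  rw [this]
  simp only [signVector, Fin.cons_zero]
  norm_num

lemma mono_signVector {m : ℕ} (γ : Fin (m + 3) →₀ ℕ) :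
    mono (signVector m) γ = (-1) ^ (γ 0 + γ 1) := by
  simp [mono, signVector, Fin.prod_univ_succ (n := m + 2), Fin.prod_univ_succ (n := m + 1), pow_add]

end SosSonc

theorem mainTheorem1 (n d : ℕ) (hn : 2 ≤ n) (hd : 1 ≤ d)
    (hnd : ¬ SosSonc.IsHilbertCase n d) :
    SosSonc.SOS n d ∪ SosSonc.SONC n d ⊂ SosSonc.SOSplusSONC n d ∧
      SosSonc.SOSplusSONC n d ⊂ SosSonc.PSD n d := by
  simp only [SosSonc.IsHilbertCase, not_or, not_and] at hnd
  obtain ⟨h1, h2, h3⟩ := hnd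
  -- Outside the Hilbert cases, d < 3 forces d = 2 and n ≥ 4, while d ≥ 3 leaves n ≥ 3.
  rcases Nat.lt_or_ge d 3 with hd3 | hd3
  · obtain rfl : d = 2 := by omega
    obtain ⟨m, rfl⟩ : ∃ m, n = m + 4 := ⟨n - 4, by omega⟩
    refine (SosSonc.isRigidSimplex_choiLam m).ssubset (i₀ := 0) (i₁ := 1) (i₂ := 2) (by decide)
      (by decide) (fun h => ?_) (SosSonc.signVector_sq (m + 1)) ?_ (SosSonc.signVector_ne (m + 1))
    · simpa [SosSonc.choiLam, SosSonc.exp4_apply] using h 0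
    · rw [SosSonc.mono_signVector, (SosSonc.exp4_apply 1 1 1 1).1,
        (SosSonc.exp4_apply 1 1 1 1).2.1]
      norm_num
  · obtain ⟨l, rfl⟩ : ∃ l, d = l + 3 := ⟨d - 3, by omega⟩
    obtain ⟨m, rfl⟩ : ∃ m, n = m + 3 := ⟨n - 3, by omega⟩
    refine (SosSonc.isRigidSimplex_motzkin m l).ssubset (i₀ := 0) (i₁ := 1) (i₂ := 2) (by decide)
      (by decide) (fun h => ?_) (SosSonc.signVector_sq m) ?_ (SosSonc.signVector_ne m)
    · have := h 0
      simp [SosSonc.motzkin, SosSonc.exp3_apply] at this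
      exact absurd this (by decide)
    · rw [SosSonc.mono_signVector, (SosSonc.exp3_apply 2 2 (2 * l + 2)).1,
        (SosSonc.exp3_apply 2 2 (2 * l + 2)).2.1]
      norm_num
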